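/- Let $\mathcal H=L^2(\mathbb R)$, and for $q,p\in\mathbb R$ let $U(q),V(p)$ be the unitary operators $(U(q)\psi)(x)=\psi(x-q)$ and $(V(p)\psi)(x)=e^{ipx}\psi(x)$ on $\mathcal H$. An observable on a measurable space $(\Omega,\mathcal A)$ is a normalized positive operator measure $E:\mathcal A\to\mathcal L(\mathcal H)$ ($\sigma$-additive in the weak operator topology, $E(X)\ge O$ for all $X\in\mathcal A$, and $E(\Omega)=I$); it is sharp if every $E(X)$ is a projection. Its range is $\operatorname{ran}(E)=\{E(X)\mid X\in\mathcal A\}$. Two observables $E_1,E_2$ are coexistent if there are a measurable space $(\Omega,\mathcal A)$ and an observable $G:\mathcal A\to\mathcal L(\mathcal H)$ with $\operatorname{ran}(E_1)\cup\operatorname{ran}(E_2)\subseteq\operatorname{ran}(G)$. A position observable is an observable $E:\mathcal B(\mathbb R)\to\mathcal L(\mathcal H)$ with $U(q)E(X)U(q)^*=E(X+q)$ and $V(p)E(X)V(p)^*=E(X)$ for all $q,p\in\mathbb R$ and $X\in\mathcal B(\mathbb R)$. A momentum observable is an observable $F:\mathcal B(\mathbb R)\to\mathcal L(\mathcal H)$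 with $V(p)F(Y)V(p)^*=F(Y+p)$ and $U(q)F(Y)U(q)^*=F(Y)$ for all $q,p\in\mathbb R$ and $Y\in\mathcal B(\mathbb R)$. **Corollary.** (1) Let $E$ be a position observable which is a convex combination of two sharp position observables, that is, $E(X)=tE_1(X)+(1-t)E_2(X)$ for all $X\in\mathcal B(\mathbb R)$, where $0\le t\le 1$ and $E_1,E_2$ are sharp position observables. Then $E$ is not coexistent with any momentum observable $F$. (2) Let $F$ be a momentum observable which is a convex combination of two sharp momentum observables. Then $F$ is not coexistent with any position observable $E$. -/

import Mathlib

open MeasureTheory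
open scoped InnerProductSpace ENNReal

universe uΩ₁ uΩ₂ uH w

/-- An observable on the measurable space `Ω` with values in the bounded operators on `H`: a
normalized positive operator measure, `σ`-additive in the weak operator topology.
The field `eff` is only meaningful on measurable sets, and every notion below only ever
evaluates it there. -/
structure Observable (Ω : Type uΩ₁) [MeasurableSpace Ω] (H : Type uH)
    [NormedAddCommGroup H] [InnerProductSpace ℂ H] where
  /-- the operator `E(X)` attached to the measurable set `X` -/
  eff : Set Ω → (H →L[ℂ] H)
  isPositive : ∀ X, MeasurableSet X → (eff X).IsPositive
  eff_univ : eff Set.univ = ContinuousLinearMap.id ℂ H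
  hasSum_iUnion : ∀ X : ℕ → Set Ω, (∀ n, MeasurableSet (X n)) →
    Pairwise (fun m n => Disjoint (X m) (X n)) →
      ∀ φ ψ : H, HasSum (fun n => ⟪φ, eff (X n) ψ⟫_ℂ) ⟪φ, eff (⋃ n, X n) ψ⟫_ℂ

namespace Observable

variable {Ω : Type uΩ₁} [MeasurableSpace Ω] {Ω₂ : Type uΩ₂} [MeasurableSpace Ω₂]
  {H : Type uH} [NormedAddCommGroup H] [InnerProductSpace ℂ H]

/-- The range `{E(X) | X measurable}` of an observable. -/
def ran (E : Observable Ω H) : Set (H →L[ℂ] H) :=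
  {T | ∃ X : Set Ω, MeasurableSet X ∧ E.eff X = T}

/-- `E` is sharp if its range consists of (orthogonal) projections. -/
def IsSharp [CompleteSpace H] (E : Observable Ω H) : Prop :=
  ∀ T ∈ E.ran, IsStarProjection T

/-- `E₁` and `E₂` are coexistent if both ranges are contained in the range of one observable,
defined on some measurable space (in an arbitrary universe `w`). -/
def Coexistent (E₁ : Observable Ω H) (E₂ : Observable Ω₂ H) : Prop :=
  ∃ (Ω' : Type w) (_ : MeasurableSpace Ω') (G : Observable Ω' H), E₁.ran ∪ E₂.ran ⊆ G.ran

/-- `E = t E₁ + (1 - t) E₂` for some `t ∈ [0, 1]`. -/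
def IsConvexCombination (E E₁ E₂ : Observable Ω H) : Prop :=
  ∃ t : ℝ, 0 ≤ t ∧ t ≤ 1 ∧ ∀ X : Set Ω, MeasurableSet X →
    E.eff X = (t : ℂ) • E₁.eff X + ((1 - t : ℝ) : ℂ) • E₂.eff X

end Observable

/-- The Hilbert space `L²(ℝ)`. -/
abbrev L2R : Type := Lp ℂ 2 (volume : Measure ℝ)

/-- Space translations: `(U(q)ψ)(x) = ψ(x - q)`. -/
noncomputable def translationU (q : ℝ) : L2R →L[ℂ] L2R :=
  (Lp.compMeasurePreservingₗᵢ ℂ (fun x : ℝ => x - q)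
    (measurePreserving_sub_right volume q)).toContinuousLinearMap

theorem translationU_coeFn (q : ℝ) (ψ : L2R) :
    translationU q ψ =ᵐ[volume] fun x => ψ (x - q) :=
  Lp.coeFn_compMeasurePreserving ψ (measurePreserving_sub_right volume q)

theorem memLp_boost (p : ℝ) (ψ : L2R) :
    MemLp (fun x : ℝ => Complex.exp (Complex.I * p * x) * ψ x) 2 volume := by
  refine (Lp.memLp ψ).congr_norm ?_ (Filter.Eventually.of_forall fun x => ?_)
  · exact (Continuous.aestronglyMeasurable (by fun_prop)).mul (Lp.aestronglyMeasurable ψ)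
  · rw [norm_mul, show Complex.I * p * x = ((p * x : ℝ) : ℂ) * Complex.I by push_cast; ring,
      Complex.norm_exp_ofReal_mul_I, one_mul]

/-- Velocity boosts: `(V(p)ψ)(x) = e^{ipx} ψ(x)`. -/
noncomputable def boostV (p : ℝ) : L2R →L[ℂ] L2R :=
  LinearMap.mkContinuous
    { toFun := fun ψ => (memLp_boost p ψ).toLp _
      map_add' := fun ψ φ => by
        rw [← MemLp.toLp_add]
        refine MemLp.toLp_congr _ _ ?_
        filter_upwards [Lp.coeFn_add ψ φ] with x hx
        rw [hx]
        simp [mul_add]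
      map_smul' := fun c ψ => by
        rw [RingHom.id_apply, ← MemLp.toLp_const_smul]
        refine MemLp.toLp_congr _ _ ?_
        filter_upwards [Lp.coeFn_smul c ψ] with x hx
        rw [hx]
        simp [mul_left_comm] }
    1 (fun ψ => by
      rw [one_mul]
      refine Lp.norm_le_norm_of_ae_le ?_
      filter_upwards [MemLp.coeFn_toLp (memLp_boost p ψ)] with x hx
      refine le_of_eq ((congrArg norm hx).trans ?_)
      rw [norm_mul, show Complex.I * p * x = ((p * x : ℝ) : ℂ) * Complex.I by push_cast; ring,
        Complex.norm_exp_ofReal_mul_I, one_mul])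

theorem boostV_coeFn (p : ℝ) (ψ : L2R) :
    boostV p ψ =ᵐ[volume] fun x => Complex.exp (Complex.I * p * x) * ψ x :=
  MemLp.coeFn_toLp (memLp_boost p ψ)

/-- Conjugation `T ↦ A T A*`. -/
noncomputable def conjBy (A T : L2R →L[ℂ] L2R) : L2R →L[ℂ] L2R :=
  A ∘L T ∘L ContinuousLinearMap.adjoint A

/-- The translate `X + q`. -/
def shiftSet (X : Set ℝ) (q : ℝ) : Set ℝ := (fun x => x + q) '' X

/-- A position observable: translation covariant and velocity boost invariant. -/
def IsPositionObservable (E : Observable ℝ L2R) : Prop :=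
  ∀ (q p : ℝ) (X : Set ℝ), MeasurableSet X →
    conjBy (translationU q) (E.eff X) = E.eff (shiftSet X q) ∧
    conjBy (boostV p) (E.eff X) = E.eff X

/-- A momentum observable: velocity boost covariant and translation invariant. -/
def IsMomentumObservable (F : Observable ℝ L2R) : Prop :=
  ∀ (q p : ℝ) (Y : Set ℝ), MeasurableSet Y →
    conjBy (boostV p) (F.eff Y) = F.eff (shiftSet Y p) ∧
    conjBy (translationU q) (F.eff Y) = F.eff Y

open Filter Topology

/-! Let `A` be the group under which the sharp observables `E₁`, `E₂` are covariant and `B` the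
group that leaves them invariant. Covariance gives `∫ e^{ipx} dEᵢ` the Weyl commutation relations of
`B p`, so by irreducibility it equals `cᵢ(p) B p`; sharpness makes `cᵢ` a unimodular character of
`ℝ`. The ratio `c₁/c₂` is continuous at `0`, hence equals `1` at some `p > 0`. Then `c₁` and `c₂`
agree on all multiples of `p`, and Fourier series show that `E₁` and `E₂` coincide on sets of period
`2π/p` (`IsWeylPair.exists_period`).

On those sets the mixture is therefore projection-valued, whatever the weights. A projection in the
range of an observable commutes with the whole range (`Observable.commute_of_isStarProjection`), so
a coexistent `F` commutes with `E₁` on periodic sets, and hence with `B p`. If `F` is covariant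
under `B`, this makes `F` periodic, which no normalized measure on the line can be
(`Observable.not_periodic`).

Working with an abstract `IsWeylPair` treats position and momentum at once, without the
Fourier–Plancherel operator. -/

/-! ### Positive operators -/

theorem ContinuousLinearMap.ext_inner_self {H : Type*} [NormedAddCommGroup H]
    [InnerProductSpace ℂ H] {S T : H →L[ℂ] H} (h : ∀ ψ, ⟪ψ, S ψ⟫_ℂ = ⟪ψ, T ψ⟫_ℂ) : S = T := by
  have h1 : (S : H →ₗ[ℂ] H) = T := by
    rw [← ext_inner_map]
    intro x
    have := congrArg (starRingEnd ℂ) (h x)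
    simpa using this
  exact ContinuousLinearMap.coe_injective h1

/-- Writing `T = S* S` turns the quadratic form into `‖S x‖²`. -/
theorem ContinuousLinearMap.IsPositive.apply_eq_zero {H : Type*} [NormedAddCommGroup H]
    [InnerProductSpace ℂ H] [CompleteSpace H] {T : H →L[ℂ] H} (hT : T.IsPositive) {x : H}
    (hx : ⟪x, T x⟫_ℂ = 0) : T x = 0 := by
  obtain ⟨S, rfl⟩ := CStarAlgebra.nonneg_iff_eq_star_mul_self.mp
    ((ContinuousLinearMap.nonneg_iff_isPositive T).mpr hT)
  have h1 : S x = 0 := by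
    rw [← inner_self_eq_zero (𝕜 := ℂ), ← hx]
    simp [ContinuousLinearMap.star_eq_adjoint, ContinuousLinearMap.adjoint_inner_right]
  simp [h1]

/-- A positive operator whose quadratic form vanishes on the kernel of a projection is absorbed
by that projection. -/
theorem ContinuousLinearMap.IsPositive.mul_eq_self_of_le {H : Type*} [NormedAddCommGroup H]
    [InnerProductSpace ℂ H] [CompleteSpace H] {T P : H →L[ℂ] H} (hT : T.IsPositive)
    (hP : IsStarProjection P) (h : ∀ ψ, (⟪ψ, T ψ⟫_ℂ).re ≤ (⟪ψ, P ψ⟫_ℂ).re) :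
    T * P = T ∧ P * T = T := by
  have h1 : T * P = T := by
    ext x
    have hz : P (x - P x) = 0 := by
      rw [map_sub, sub_eq_zero]
      exact (DFunLike.congr_fun hP.isIdempotentElem.eq x).symm
    have h2 := h (x - P x)
    rw [hz, inner_zero_right] at h2
    have h3 := hT.inner_nonneg_right (x - P x)
    rw [Complex.le_def] at h3
    have h4 : T (x - P x) = 0 := by
      apply hT.apply_eq_zero
      apply Complex.ext
      · exact le_antisymm h2 h3.1
      · exact h3.2.symm
    rw [map_sub, sub_eq_zero] at h4
    exact h4.symm
  refine ⟨h1, ?_⟩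
  have h2 := congrArg star h1
  rwa [star_mul, hP.isSelfAdjoint.star_eq, hT.isSelfAdjoint.star_eq] at h2

/-! ### Observables and integrals of simple functions -/

namespace Observable

variable {Ω : Type*} [MeasurableSpace Ω] {H : Type*} [NormedAddCommGroup H]
  [InnerProductSpace ℂ H] (E : Observable Ω H)

theorem inner_eff_empty (φ ψ : H) : ⟪φ, E.eff ∅ ψ⟫_ℂ = 0 := by
  have h := (E.hasSum_iUnion (fun _ => ∅) (fun _ => MeasurableSet.empty)
    (fun _ _ _ => by simp) φ ψ).summable
  exact (summable_const_iff _).mp h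

theorem re_inner_eff_nonneg {X : Set Ω} (hX : MeasurableSet X) (ψ : H) :
    0 ≤ (⟪ψ, E.eff X ψ⟫_ℂ).re :=
  (Complex.le_def.mp ((E.isPositive X hX).inner_nonneg_right ψ)).1

/-- The distribution of the observable `E` in the vector state `ψ`. -/
noncomputable def distribution (ψ : H) : Measure Ω :=
  Measure.ofMeasurable (fun X _ => ENNReal.ofReal (⟪ψ, E.eff X ψ⟫_ℂ).re)
    (by simp [inner_eff_empty])
    (by
      intro X hX hd
      have h := Complex.hasSum_re (E.hasSum_iUnion X hX hd ψ ψ)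
      rw [← h.tsum_eq, ENNReal.ofReal_tsum_of_nonneg
        (fun n => E.re_inner_eff_nonneg (hX n) ψ) h.summable])

theorem distribution_apply (ψ : H) {X : Set Ω} (hX : MeasurableSet X) :
    E.distribution ψ X = ENNReal.ofReal (⟪ψ, E.eff X ψ⟫_ℂ).re :=
  Measure.ofMeasurable_apply X hX

instance (ψ : H) : IsFiniteMeasure (E.distribution ψ) :=
  ⟨by rw [E.distribution_apply ψ MeasurableSet.univ]; exact ENNReal.ofReal_lt_top⟩

theorem inner_eff (ψ : H) {X : Set Ω} (hX : MeasurableSet X) :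
    ⟪ψ, E.eff X ψ⟫_ℂ = ((E.distribution ψ).real X : ℂ) := by
  have h := Complex.le_def.mp ((E.isPositive X hX).inner_nonneg_right ψ)
  rw [measureReal_def, E.distribution_apply ψ hX, ENNReal.toReal_ofReal h.1]
  apply Complex.ext
  · simp
  · simpa using h.2.symm

theorem distribution_real_univ (ψ : H) : (E.distribution ψ).real Set.univ = ‖ψ‖ ^ 2 := by
  have h := E.inner_eff ψ MeasurableSet.univ
  rw [E.eff_univ, ContinuousLinearMap.id_apply, inner_self_eq_norm_sq_to_K] at h
  apply Complex.ofReal_injective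
  rw [← h]
  push_cast
  rfl

theorem eff_union {X Y : Set Ω} (hX : MeasurableSet X) (hY : MeasurableSet Y)
    (h : Disjoint X Y) : E.eff (X ∪ Y) = E.eff X + E.eff Y := by
  refine ContinuousLinearMap.ext_inner_self fun ψ => ?_
  rw [add_apply, inner_add_right, E.inner_eff ψ (hX.union hY),
    E.inner_eff ψ hX, E.inner_eff ψ hY, measureReal_union h hY]
  push_cast
  rfl

theorem re_inner_eff_mono {X Y : Set Ω} (hX : MeasurableSet X) (hY : MeasurableSet Y)
    (h : X ⊆ Y) (ψ : H) : (⟪ψ, E.eff X ψ⟫_ℂ).re ≤ (⟪ψ, E.eff Y ψ⟫_ℂ).re := by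
  rw [E.inner_eff ψ hX, E.inner_eff ψ hY]
  simpa using measureReal_mono h

/-- `E(Y ∩ X) ≤ E(X)` is absorbed by the projection `E(X)`, while `E(Y \ X) ≤ 1 - E(X)` is
annihilated by it; adding the two gives the claim. Only `E(X)` has to be a projection, so this
applies to a joint observable that is not sharp. -/
theorem eff_mul_eff_of_isStarProjection [CompleteSpace H] {X Y : Set Ω} (hX : MeasurableSet X)
    (hY : MeasurableSet Y) (hP : IsStarProjection (E.eff X)) :
    E.eff Y * E.eff X = E.eff (Y ∩ X) ∧ E.eff X * E.eff Y = E.eff (Y ∩ X) := by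
  have hYX := hY.inter hX
  have hYd := hY.diff hX
  have h1 := (E.isPositive _ hYX).mul_eq_self_of_le hP
    (E.re_inner_eff_mono hYX hX Set.inter_subset_right)
  have hc : E.eff Xᶜ = 1 - E.eff X := by
    have := E.eff_union hX hX.compl disjoint_compl_right
    rw [Set.union_compl_self, E.eff_univ] at this
    rw [eq_sub_iff_add_eq, add_comm, ← this]
    rfl
  have h2 := (E.isPositive _ hYd).mul_eq_self_of_le (P := E.eff Xᶜ) (by
      rw [hc]; exact hP.one_sub)
    (E.re_inner_eff_mono hYd hX.compl fun x hx => hx.2)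
  rw [hc, mul_sub, sub_mul, mul_one, one_mul, sub_eq_self, sub_eq_self] at h2
  have h3 := E.eff_union hYX hYd (Set.disjoint_sdiff_inter.symm)
  rw [Set.inter_union_sdiff] at h3
  rw [h3, add_mul, mul_add, h1.1, h1.2, h2.1, h2.2]
  simp

/-- A projection in the range of an observable commutes with the whole range. -/
theorem commute_of_isStarProjection [CompleteSpace H] {S T : H →L[ℂ] H} (hS : S ∈ E.ran)
    (hP : IsStarProjection S) (hT : T ∈ E.ran) : Commute S T := by
  obtain ⟨X, hX, rfl⟩ := hS
  obtain ⟨Y, hY, rfl⟩ := hT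
  have h := E.eff_mul_eff_of_isStarProjection hX hY hP
  exact h.2.trans h.1.symm

/-- The integral of a simple function against an observable. -/
noncomputable def simpleIntegral (s : SimpleFunc Ω ℂ) : H →L[ℂ] H :=
  ∑ z ∈ s.range, z • E.eff (s ⁻¹' {z})

theorem inner_simpleIntegral (s : SimpleFunc Ω ℂ) (ψ : H) :
    ⟪ψ, E.simpleIntegral s ψ⟫_ℂ = ∫ x, s x ∂E.distribution ψ := by
  rw [← SimpleFunc.integral_eq_integral _ (SimpleFunc.integrable_of_isFiniteMeasure s),
    SimpleFunc.integral_eq, simpleIntegral,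
    sum_apply, inner_sum]
  refine Finset.sum_congr rfl fun z _ => ?_
  rw [smul_apply, inner_smul_right,
    E.inner_eff ψ (SimpleFunc.measurableSet_preimage s _), Complex.real_smul, mul_comm]

theorem simpleIntegral_sub (s t : SimpleFunc Ω ℂ) :
    E.simpleIntegral (s - t) = E.simpleIntegral s - E.simpleIntegral t := by
  refine ContinuousLinearMap.ext_inner_self fun ψ => ?_
  rw [sub_apply, inner_sub_right]
  simp only [inner_simpleIntegral, SimpleFunc.coe_sub, Pi.sub_apply]
  exact integral_sub (SimpleFunc.integrable_of_isFiniteMeasure s)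
    (SimpleFunc.integrable_of_isFiniteMeasure t)

theorem star_simpleIntegral [CompleteSpace H] (s : SimpleFunc Ω ℂ) :
    star (E.simpleIntegral s) = E.simpleIntegral (s.map (starRingEnd ℂ)) := by
  refine ContinuousLinearMap.ext_inner_self fun ψ => ?_
  rw [ContinuousLinearMap.star_eq_adjoint, ContinuousLinearMap.adjoint_inner_right,
    ← inner_conj_symm, inner_simpleIntegral, inner_simpleIntegral, ← integral_conj]
  rfl

/-- For sharp `E` the product of two effects is the effect of the intersection, so the double sum
runs over the level sets of the pair `(s, t)`; values that are not attained contribute `0`. -/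
theorem simpleIntegral_mul [CompleteSpace H] (hE : E.IsSharp) (s t : SimpleFunc Ω ℂ) :
    E.simpleIntegral s * E.simpleIntegral t = E.simpleIntegral (s * t) := by
  refine ContinuousLinearMap.ext_inner_self fun ψ => ?_
  have h1 : ∀ z w, ⟪ψ, E.eff (s ⁻¹' {z}) (E.eff (t ⁻¹' {w}) ψ)⟫_ℂ =
      ((E.distribution ψ).real (s.pair t ⁻¹' {(z, w)}) : ℂ) := by
    intro z w
    have hz := SimpleFunc.measurableSet_preimage s {z}
    have hw := SimpleFunc.measurableSet_preimage t {w}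
    have := (E.eff_mul_eff_of_isStarProjection hw hz (hE _ ⟨_, hw, rfl⟩)).1
    rw [← mul_apply_eq_comp, this, E.inner_eff ψ (hz.inter hw),
      SimpleFunc.pair_preimage_singleton]
  have h2 : ∫ x, (s * t) x ∂E.distribution ψ =
      ∫ x, ((s.pair t).map fun z => z.1 * z.2) x ∂E.distribution ψ := rfl
  rw [inner_simpleIntegral, h2, ← SimpleFunc.integral_eq_integral _
    (SimpleFunc.integrable_of_isFiniteMeasure _), SimpleFunc.map_integral _ _
    (SimpleFunc.integrable_of_isFiniteMeasure _) (by simp)]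
  rw [mul_apply_eq_comp, simpleIntegral, simpleIntegral,
    sum_apply, sum_apply, inner_sum]
  have h3 : (s.pair t).range ⊆ s.range ×ˢ t.range := by
    intro z hz
    obtain ⟨x, rfl⟩ := SimpleFunc.mem_range.mp hz
    simp
  rw [Finset.sum_subset h3 (by
    intro z _ hz
    have : s.pair t ⁻¹' {z} = ∅ := by
      rw [SimpleFunc.preimage_eq_empty_iff]; exact hz
    simp [this]), Finset.sum_product]
  refine Finset.sum_congr rfl fun z _ => ?_
  rw [smul_apply, map_sum, inner_smul_right, inner_sum, Finset.mul_sum]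
  refine Finset.sum_congr rfl fun w _ => ?_
  rw [smul_apply, map_smul, inner_smul_right, h1, Complex.real_smul]
  ring

/-- By multiplicativity `‖E(s)ψ‖² = ∫ |s|²` against the distribution of `ψ`. Uniform convergence of
functions thus becomes norm convergence of operators. -/
theorem norm_simpleIntegral_le [CompleteSpace H] (hE : E.IsSharp) (s : SimpleFunc Ω ℂ) {C : ℝ}
    (hC : 0 ≤ C) (hs : ∀ x, ‖s x‖ ≤ C) : ‖E.simpleIntegral s‖ ≤ C := by
  refine ContinuousLinearMap.opNorm_le_bound _ hC fun ψ => ?_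
  have h1 : ((‖E.simpleIntegral s ψ‖ ^ 2 : ℝ) : ℂ) =
      ∫ x, (starRingEnd ℂ (s x) * s x) ∂E.distribution ψ := by
    have h2 := E.inner_simpleIntegral (s.map (starRingEnd ℂ) * s) ψ
    rw [← E.simpleIntegral_mul hE, ← star_simpleIntegral, mul_apply_eq_comp,
      ContinuousLinearMap.star_eq_adjoint, ContinuousLinearMap.adjoint_inner_right,
      inner_self_eq_norm_sq_to_K] at h2
    push_cast
    exact h2
  have h3 : ‖E.simpleIntegral s ψ‖ ^ 2 ≤ C ^ 2 * ‖ψ‖ ^ 2 := by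
    rw [← E.distribution_real_univ ψ]
    have h4 := norm_integral_le_of_norm_le_const (μ := E.distribution ψ)
      (f := fun x => starRingEnd ℂ (s x) * s x) (C := C ^ 2) (.of_forall fun x => by
        rw [norm_mul, RCLike.norm_conj, ← sq]
        exact pow_le_pow_left₀ (norm_nonneg _) (hs x) 2)
    rw [← h1, Complex.norm_real, Real.norm_of_nonneg (by positivity)] at h4
    exact h4
  rw [← mul_pow] at h3
  exact le_of_sq_le_sq h3 (by positivity)

/-- `T` is the integral of the function `f` against `E`, in the weak sense. -/
def IsIntegral (f : Ω → ℂ) (T : H →L[ℂ] H) : Prop :=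
  ∀ ψ, ⟪ψ, T ψ⟫_ℂ = ∫ x, f x ∂E.distribution ψ

variable {E} in
theorem IsIntegral.unique {f : Ω → ℂ} {S T : H →L[ℂ] H} (hS : E.IsIntegral f S)
    (hT : E.IsIntegral f T) : S = T :=
  ContinuousLinearMap.ext_inner_self fun ψ => (hS ψ).trans (hT ψ).symm

theorem isIntegral_one : E.IsIntegral (fun _ => 1) 1 := by
  intro ψ
  rw [integral_const, distribution_real_univ, one_apply_eq_self,
    inner_self_eq_norm_sq_to_K]
  simp

end Observable

/-! ### Integrals of bounded functions against a sharp observable -/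

/-- The disc is totally bounded. Approximating the identity on `ℂ`, rather than each `f`, yields
approximants of `f` that are functions of `f`, which `IsIntegral.commute` relies on. -/
theorem exists_simpleFunc_dist_id_le :
    ∃ σ : ℕ → SimpleFunc ℂ ℂ, ∀ n z, ‖z‖ ≤ 1 → ‖σ n z - z‖ ≤ 1 / ((n : ℝ) + 1) := by
  have key : ∀ ε : ℝ, 0 < ε → ∃ s : SimpleFunc ℂ ℂ, ∀ z, ‖z‖ ≤ 1 → ‖s z - z‖ ≤ ε := by
    intro ε hε
    obtain ⟨t, -, htf, ht⟩ := (isCompact_closedBall (0 : ℂ) 1).finite_cover_balls hε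
    obtain ⟨w, hw⟩ : ∃ w, w ∈ t := by
      have := ht (Metric.mem_closedBall_self zero_le_one)
      simp only [Set.mem_iUnion] at this
      obtain ⟨w, hw, -⟩ := this
      exact ⟨w, hw⟩
    obtain ⟨e, he⟩ := htf.countable.exists_eq_range ⟨w, hw⟩
    -- The sequence `e` may list the finitely many centres with repetitions; `N` is an index by
    -- which all have appeared.
    have hN : ∃ N, ∀ y ∈ t, ∃ k ≤ N, e k = y := by
      have : ∀ y ∈ t, ∃ k, e k = y := fun y hy => by rw [he] at hy; exact hy
      choose! g hg using this
      refine ⟨htf.toFinset.sup g, fun y hy => ⟨g y, Finset.le_sup (by simpa using hy), hg y hy⟩⟩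
    obtain ⟨N, hN⟩ := hN
    refine ⟨SimpleFunc.nearestPt e N, fun z hz => ?_⟩
    have h1 := ht (show z ∈ Metric.closedBall 0 1 by simpa using hz)
    simp only [Set.mem_iUnion] at h1
    obtain ⟨y, hy, hyz⟩ := h1
    obtain ⟨k, hk, rfl⟩ := hN y hy
    have h2 := SimpleFunc.edist_nearestPt_le e z hk
    rw [edist_dist, edist_dist, ENNReal.ofReal_le_ofReal_iff dist_nonneg] at h2
    rw [← dist_eq_norm]
    rw [Metric.mem_ball, dist_comm] at hyz
    exact h2.trans hyz.le
  choose σ hσ using fun n : ℕ => key (1 / ((n : ℝ) + 1)) Nat.one_div_pos_of_nat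
  exact ⟨σ, hσ⟩

/-- Simple functions that approximate the identity uniformly on the unit disc. -/
noncomputable def discApprox : ℕ → SimpleFunc ℂ ℂ := exists_simpleFunc_dist_id_le.choose

theorem norm_discApprox_sub_le (n : ℕ) {z : ℂ} (hz : ‖z‖ ≤ 1) :
    ‖discApprox n z - z‖ ≤ 1 / ((n : ℝ) + 1) :=
  exists_simpleFunc_dist_id_le.choose_spec n z hz

theorem tendsto_discApprox {z : ℂ} (hz : ‖z‖ ≤ 1) :
    Tendsto (fun n => discApprox n z) atTop (𝓝 z) := by
  rw [tendsto_iff_norm_sub_tendsto_zero]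
  exact squeeze_zero (fun _ => norm_nonneg _) (fun n => norm_discApprox_sub_le n hz)
    tendsto_one_div_add_atTop_nhds_zero_nat

theorem norm_discApprox_le (n : ℕ) {z : ℂ} (hz : ‖z‖ ≤ 1) : ‖discApprox n z‖ ≤ 2 := by
  have h1 := norm_discApprox_sub_le n hz
  have h2 : 1 / ((n : ℝ) + 1) ≤ 1 := by
    rw [div_le_one (by positivity)]
    linarith [n.cast_nonneg (α := ℝ)]
  have h3 := norm_add_le (discApprox n z - z) z
  rw [sub_add_cancel] at h3
  linarith

namespace Observable

variable {Ω : Type*} [MeasurableSpace Ω] {H : Type*} [NormedAddCommGroup H]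
  [InnerProductSpace ℂ H] [CompleteSpace H] {E : Observable Ω H}

theorem exists_isIntegral (hE : E.IsSharp) {f : Ω → ℂ} (hf : Measurable f)
    (hf1 : ∀ x, ‖f x‖ ≤ 1) : ∃ T, E.IsIntegral f T ∧
      Tendsto (fun n => E.simpleIntegral ((discApprox n).comp f hf)) atTop (𝓝 T) := by
  have hc : CauchySeq (fun n => E.simpleIntegral ((discApprox n).comp f hf)) := by
    refine cauchySeq_of_le_tendsto_0 (fun N : ℕ => 1 / ((N : ℝ) + 1) + 1 / ((N : ℝ) + 1)) ?_ ?_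
    · intro n m N hn hm
      rw [dist_eq_norm, ← simpleIntegral_sub]
      refine norm_simpleIntegral_le E hE _ (by positivity) fun x => ?_
      have h1 := (norm_discApprox_sub_le n (hf1 x)).trans (Nat.one_div_le_one_div hn)
      have h2 := (norm_discApprox_sub_le m (hf1 x)).trans (Nat.one_div_le_one_div hm)
      have h3 := norm_sub_le (discApprox n (f x) - f x) (discApprox m (f x) - f x)
      rw [sub_sub_sub_cancel_right] at h3
      exact h3.trans (add_le_add h1 h2)
    · simpa using (tendsto_one_div_add_atTop_nhds_zero_nat (𝕜 := ℝ)).add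
        tendsto_one_div_add_atTop_nhds_zero_nat
  obtain ⟨T, hT⟩ := cauchySeq_tendsto_of_complete hc
  refine ⟨T, fun ψ => ?_, hT⟩
  have h1 : Tendsto (fun n => ⟪ψ, E.simpleIntegral ((discApprox n).comp f hf) ψ⟫_ℂ) atTop
      (𝓝 ⟪ψ, T ψ⟫_ℂ) :=
    tendsto_const_nhds.inner (((ContinuousLinearMap.apply ℂ H ψ).continuous.tendsto T).comp hT)
  refine tendsto_nhds_unique h1 ?_
  simp_rw [inner_simpleIntegral]
  refine tendsto_integral_of_dominated_convergence (fun _ => 2)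
    (fun n => ((discApprox n).comp f hf).aestronglyMeasurable) (integrable_const _)
    (fun n => .of_forall fun x => norm_discApprox_le n (hf1 x))
    (.of_forall fun x => tendsto_discApprox (hf1 x))

theorem IsIntegral.tendsto (hE : E.IsSharp) {f : Ω → ℂ} (hf : Measurable f)
    (hf1 : ∀ x, ‖f x‖ ≤ 1) {T : H →L[ℂ] H} (hT : E.IsIntegral f T) :
    Tendsto (fun n => E.simpleIntegral ((discApprox n).comp f hf)) atTop (𝓝 T) := by
  obtain ⟨S, hS, hS2⟩ := exists_isIntegral hE hf hf1
  rwa [hT.unique hS]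

/-- The approximants converge in norm, so their products converge to `S * T`; weak convergence would
not suffice. -/
theorem IsIntegral.mul (hE : E.IsSharp) {f g : Ω → ℂ} (hf : Measurable f) (hg : Measurable g)
    (hf1 : ∀ x, ‖f x‖ ≤ 1) (hg1 : ∀ x, ‖g x‖ ≤ 1) {S T : H →L[ℂ] H} (hS : E.IsIntegral f S)
    (hT : E.IsIntegral g T) : E.IsIntegral (fun x => f x * g x) (S * T) := by
  intro ψ
  have h0 := (hS.tendsto hE hf hf1).mul (hT.tendsto hE hg hg1)
  have h1 := Tendsto.inner (𝕜 := ℂ) (tendsto_const_nhds (x := ψ))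
    (((ContinuousLinearMap.apply ℂ H ψ).continuous.tendsto (S * T)).comp h0)
  refine tendsto_nhds_unique h1 ?_
  simp only [Function.comp_def, ContinuousLinearMap.apply_apply, simpleIntegral_mul E hE,
    inner_simpleIntegral]
  refine tendsto_integral_of_dominated_convergence (fun _ => 2 * 2)
    (fun n => SimpleFunc.aestronglyMeasurable _) (integrable_const _)
    (fun n => .of_forall fun x => ?_)
    (.of_forall fun x => (tendsto_discApprox (hf1 x)).mul (tendsto_discApprox (hg1 x)))
  rw [SimpleFunc.coe_mul, Pi.mul_apply, norm_mul]
  exact mul_le_mul (norm_discApprox_le n (hf1 x)) (norm_discApprox_le n (hg1 x))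
    (norm_nonneg _) zero_le_two

theorem IsIntegral.star {f : Ω → ℂ} {T : H →L[ℂ] H} (hT : E.IsIntegral f T) :
    E.IsIntegral (fun x => starRingEnd ℂ (f x)) (star T) := by
  intro ψ
  rw [ContinuousLinearMap.star_eq_adjoint, ContinuousLinearMap.adjoint_inner_right,
    ← inner_conj_symm, hT, integral_conj]

/-- The integral of `f` commutes with everything that commutes with `E` on the sets
measurable with respect to `f`. -/
theorem IsIntegral.commute (hE : E.IsSharp) {f : Ω → ℂ} (hf : Measurable f)
    (hf1 : ∀ x, ‖f x‖ ≤ 1) {S T : H →L[ℂ] H} (hS : E.IsIntegral f S)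
    (hT : ∀ B, MeasurableSet B → Commute (E.eff (f ⁻¹' B)) T) : Commute S T := by
  have h := hS.tendsto hE hf hf1
  refine tendsto_nhds_unique (h.mul_const T) ?_
  refine (h.const_mul T).congr fun n => ?_
  refine (Commute.sum_left _ _ _ fun z _ => ?_ : Commute (E.simpleIntegral _) T).symm.eq
  -- Level sets of the approximant are preimages under `f` of measurable sets.
  exact (hT (discApprox n ⁻¹' {z}) (SimpleFunc.measurableSet_preimage _ _)).smul_left z

end Observable

/-! ### Two facts from Fourier analysis -/

/-- A unimodular character of `ℝ` that is continuous at `0` has a nontrivial kernel. -/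
theorem AddChar.exists_pos_apply_eq_one (r : AddChar ℝ ℂ) (hr : ContinuousAt r 0)
    (hn : ∀ p, ‖r p‖ = 1) : ∃ p, 0 < p ∧ r p = 1 := by
  by_contra! h
  have hcont : Continuous r := by
    rw [continuous_iff_continuousAt]
    intro p
    have h1 : ContinuousAt (fun x => r p * r (x - p)) p := by
      refine continuousAt_const.mul (ContinuousAt.comp (g := r) ?_ (by fun_prop))
      rwa [sub_self]
    refine h1.congr (.of_forall fun x => ?_)
    change r p * r (x - p) = r x
    rw [← AddChar.map_add_eq_mul, add_sub_cancel]
  have hsq : ∀ p, (r p).re * (r p).re + (r p).im * (r p).im = 1 := by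
    intro p
    rw [← Complex.normSq_apply, Complex.normSq_eq_norm_sq, hn, one_pow]
  have hdbl : ∀ p, r (2 * p) = r p * r p := fun p => by rw [two_mul, AddChar.map_add_eq_mul]
  -- A real unimodular value is `±1`, and squaring it gives `r (2p) = 1`.
  have him : ∀ p, 0 < p → (r p).im ≠ 0 := by
    intro p hp h0
    refine h (2 * p) (by positivity) ?_
    rw [hdbl]
    have h1 := hsq p
    rw [h0, mul_zero, add_zero] at h1
    apply Complex.ext <;> simp [h0, h1]
  -- If the real part were not positive, the imaginary part at `2p`, which is `2 re im`, would
  -- vanish or change sign, producing a zero in `[p, 2p]`.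
  have hre : ∀ p, 0 < p → 0 < (r p).re := by
    intro p hp
    by_contra! hneg
    have h1 := him p hp
    have h2 : (r (2 * p)).im = 2 * (r p).re * (r p).im := by rw [hdbl, Complex.mul_im]; ring
    have h3 : (r p).im * (r (2 * p)).im ≤ 0 := by
      rw [h2]
      nlinarith [mul_nonneg (neg_nonneg.mpr hneg) (mul_self_nonneg (r p).im)]
    have hci : ContinuousOn (fun x => (r x).im) (Set.Icc p (2 * p)) :=
      (Complex.continuous_im.comp hcont).continuousOn
    have hle : p ≤ 2 * p := by linarith
    obtain ⟨x, hx, hx0⟩ : ∃ x ∈ Set.Icc p (2 * p), (r x).im = 0 := by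
      rcases h1.lt_or_gt with hlt | hgt
      · exact intermediate_value_Icc hle hci ⟨hlt.le, by nlinarith⟩
      · exact intermediate_value_Icc' hle hci ⟨by nlinarith, hgt.le⟩
    exact him x (hp.trans_le hx.1) hx0
  -- With positive real part, doubling `p` at least doubles `1 - re`, which stays below `1`.
  have hgrow : ∀ n : ℕ, ∀ p, 0 < p → 2 ^ n * (1 - (r p).re) ≤ 1 := by
    intro n
    induction n with
    | zero => intro p hp; linarith [hre p hp]
    | succ n ih =>
      intro p hp
      have h1 := ih (2 * p) (by positivity)
      have h2 : (r (2 * p)).re = 2 * (r p).re ^ 2 - 1 := by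
        rw [hdbl, Complex.mul_re]; linarith [hsq p]
      have h3 : (r p).re ≤ 1 := (Complex.re_le_norm _).trans (hn p).le
      have h4 : 2 * (1 - (r p).re) ≤ 1 - (r (2 * p)).re := by
        rw [h2]; nlinarith [hre p hp]
      calc (2 : ℝ) ^ (n + 1) * (1 - (r p).re) = 2 ^ n * (2 * (1 - (r p).re)) := by ring
        _ ≤ 2 ^ n * (1 - (r (2 * p)).re) := by gcongr
        _ ≤ 1 := h1
  have hlt : 0 < 1 - (r 1).re := by
    have h1 := hsq 1
    have h2 := him 1 one_pos
    have h3 := mul_self_pos.mpr h2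
    nlinarith [hre 1 one_pos]
  obtain ⟨n, hn'⟩ := pow_unbounded_of_one_lt (1 / (1 - (r 1).re)) one_lt_two
  rw [div_lt_iff₀ hlt] at hn'
  exact (hgrow n 1 one_pos).not_gt hn'

/-- A finite measure on the circle is determined by its Fourier coefficients. -/
theorem AddCircle.measure_ext_of_integral_fourier {T : ℝ} [Fact (0 < T)]
    {μ ν : Measure (AddCircle T)} [IsFiniteMeasure μ] [IsFiniteMeasure ν]
    (h : ∀ n : ℤ, ∫ x, fourier n x ∂μ = ∫ x, fourier n x ∂ν) : μ = ν := by
  have hint : ∀ (ρ : Measure (AddCircle T)) [IsFiniteMeasure ρ] (f : C(AddCircle T, ℂ)),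
      Integrable f ρ := fun ρ _ f =>
    (integrable_const ‖f‖).mono' f.continuous.aestronglyMeasurable
      (.of_forall fun x => f.norm_coe_le_norm x)
  have hI : ∀ (ρ : Measure (AddCircle T)) [IsFiniteMeasure ρ],
      ∃ L : C(AddCircle T, ℂ) →L[ℂ] ℂ, ∀ f, L f = ∫ x, f x ∂ρ := fun ρ _ =>
    ⟨LinearMap.mkContinuous
      { toFun := fun f => ∫ x, f x ∂ρ
        map_add' := fun f g => integral_add (hint ρ f) (hint ρ g)
        map_smul' := fun c f => integral_const_mul c _ } (ρ.real Set.univ) fun f => by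
        rw [mul_comm]
        exact norm_integral_le_of_norm_le_const (.of_forall fun x => f.norm_coe_le_norm x),
      fun f => rfl⟩
  obtain ⟨L, hL⟩ := hI μ
  obtain ⟨M, hM⟩ := hI ν
  have hLM : L = M := by
    refine ContinuousLinearMap.ext_on (s := Set.range (@fourier T)) ?_ ?_
    · exact Submodule.dense_iff_topologicalClosure_eq_top.mpr span_fourier_closure_eq_top
    · rintro _ ⟨n, rfl⟩
      rw [hL, hM, h]
  refine ext_of_forall_integral_eq_of_IsFiniteMeasure fun f => ?_
  have h1 := DFunLike.congr_fun hLM ⟨fun x => ((f x : ℝ) : ℂ), by fun_prop⟩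
  rw [hL, hM] at h1
  simp only [ContinuousMap.coe_mk, integral_complex_ofReal] at h1
  exact Complex.ofReal_injective h1

/-! ### Covariant sharp observables for a Weyl pair -/

/-- A pair of one-parameter unitary groups satisfying the Weyl relations irreducibly. -/
structure IsWeylPair {H : Type*} [NormedAddCommGroup H] [InnerProductSpace ℂ H] [CompleteSpace H]
    (A B : ℝ → H →L[ℂ] H) : Prop where
  star_mul_left : ∀ q, star (A q) * A q = 1
  star_mul_right : ∀ p, star (B p) * B p = 1
  mul_star_right : ∀ p, B p * star (B p) = 1
  map_add_right : ∀ p p', B (p + p') = B p * B p'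
  weyl : ∀ q p : ℝ, A q * B p = Complex.exp (-(Complex.I * p * q)) • (B p * A q)
  irreducible : ∀ T : H →L[ℂ] H, (∀ q, Commute (A q) T) → (∀ p, Commute (B p) T) →
    ∃ c : ℂ, T = c • 1

/-- The observable `E` is covariant under `A` and invariant under `B`. -/
def Observable.IsCovariant {H : Type*} [NormedAddCommGroup H] [InnerProductSpace ℂ H]
    [CompleteSpace H] (E : Observable ℝ H) (A B : ℝ → H →L[ℂ] H) : Prop :=
  ∀ X, MeasurableSet X → (∀ q, A q * E.eff X * star (A q) = E.eff (shiftSet X q)) ∧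
    ∀ p, B p * E.eff X * star (B p) = E.eff X

theorem shiftSet_eq_preimage (X : Set ℝ) (q : ℝ) : shiftSet X q = (fun x => x - q) ⁻¹' X := by
  ext x
  simp only [shiftSet, Set.mem_image, Set.mem_preimage]
  exact ⟨by rintro ⟨y, hy, rfl⟩; simpa using hy, fun h => ⟨x - q, h, by simp⟩⟩

/-- The function `x ↦ e^{ipx}`. -/
noncomputable def planeWave (p x : ℝ) : ℂ := Complex.exp (Complex.I * p * x)

theorem norm_planeWave (p x : ℝ) : ‖planeWave p x‖ = 1 := by
  rw [planeWave, show Complex.I * p * x = ((p * x : ℝ) : ℂ) * Complex.I by push_cast; ring,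
    Complex.norm_exp_ofReal_mul_I]

theorem measurable_planeWave (p : ℝ) : Measurable (planeWave p) := by
  unfold planeWave; fun_prop

theorem Observable.continuous_integral_planeWave {H : Type*}
    [NormedAddCommGroup H] [InnerProductSpace ℂ H] (E : Observable ℝ H) (ψ : H) :
    Continuous fun p => ∫ x, planeWave p x ∂E.distribution ψ :=
  continuous_of_dominated (bound := fun _ => 1)
    (fun p => (measurable_planeWave p).aestronglyMeasurable)
    (fun p => .of_forall fun x => (norm_planeWave p x).le) (integrable_const _)
    (.of_forall fun x => by unfold planeWave; fun_prop)

namespace IsWeylPair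

variable {H : Type*} [NormedAddCommGroup H] [InnerProductSpace ℂ H] [CompleteSpace H]
  {A B : ℝ → H →L[ℂ] H} {E : Observable ℝ H}

theorem distribution_star_left (hE : E.IsCovariant A B) (q : ℝ) (ψ : H) :
    E.distribution (star (A q) ψ) = (E.distribution ψ).map (fun x => x - q) := by
  ext X hX
  rw [Measure.map_apply (by fun_prop) hX, ← shiftSet_eq_preimage,
    E.distribution_apply _ hX, E.distribution_apply _ (by
      rw [shiftSet_eq_preimage]; exact measurableSet_preimage (by fun_prop) hX),
    ← (hE X hX).1 q, ContinuousLinearMap.star_eq_adjoint,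
    ContinuousLinearMap.adjoint_inner_left]
  rfl

theorem distribution_star_right (hE : E.IsCovariant A B) (p : ℝ) (ψ : H) :
    E.distribution (star (B p) ψ) = E.distribution ψ := by
  ext X hX
  rw [E.distribution_apply _ hX, E.distribution_apply _ hX]
  nth_rw 2 [← (hE X hX).2 p]
  rw [ContinuousLinearMap.star_eq_adjoint, ContinuousLinearMap.adjoint_inner_left]
  rfl

/-- The Fourier transform of a covariant sharp observable is a multiple of the invariance
group. -/
theorem exists_isIntegral_planeWave (hAB : IsWeylPair A B) (hE : E.IsCovariant A B)
    (hs : E.IsSharp) (p : ℝ) : ∃ c : ℂ, E.IsIntegral (planeWave p) (c • B p) := by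
  obtain ⟨W, hW, -⟩ := Observable.exists_isIntegral hs (measurable_planeWave p)
    (fun x => (norm_planeWave p x).le)
  -- Covariance translates the distribution by `q`, giving `W` the same phase against `A q` that `B
  -- p` has. Hence `star (B p) * W` commutes with both groups.
  have hA : ∀ q : ℝ, A q * W = Complex.exp (-(Complex.I * p * q)) • (W * A q) := by
    intro q
    have h1 : A q * W * star (A q) = Complex.exp (-(Complex.I * p * q)) • W := by
      refine ContinuousLinearMap.ext_inner_self fun ψ => ?_
      have h2 : ⟪ψ, (A q * W * star (A q)) ψ⟫_ℂ =
          ⟪star (A q) ψ, W (star (A q) ψ)⟫_ℂ := by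
        rw [ContinuousLinearMap.star_eq_adjoint, ContinuousLinearMap.adjoint_inner_left]
        rfl
      rw [h2, hW, distribution_star_left hE, integral_map (by fun_prop)
        (measurable_planeWave p).aestronglyMeasurable, smul_apply, inner_smul_right, hW,
        ← integral_const_mul]
      congr 1 with x
      rw [planeWave, planeWave, ← Complex.exp_add]
      push_cast
      ring_nf
    rw [← smul_mul_assoc, ← h1, mul_assoc (A q * W), hAB.star_mul_left, mul_one]
  have hB : ∀ p', Commute (B p') W := by
    intro p'
    have h1 : B p' * W * star (B p') = W := by
      refine ContinuousLinearMap.ext_inner_self fun ψ => ?_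
      have h2 : ⟪ψ, (B p' * W * star (B p')) ψ⟫_ℂ =
          ⟪star (B p') ψ, W (star (B p') ψ)⟫_ℂ := by
        rw [ContinuousLinearMap.star_eq_adjoint, ContinuousLinearMap.adjoint_inner_left]
        rfl
      rw [h2, hW, distribution_star_right hE, hW]
    change B p' * W = W * B p'
    nth_rw 2 [← h1]
    rw [mul_assoc (B p' * W), hAB.star_mul_right, mul_one]
  have hconj : ∀ T : H →L[ℂ] H, star (B p) * (B p * T) = T := fun T => by
    rw [← mul_assoc, hAB.star_mul_right, one_mul]
  obtain ⟨c, hc⟩ := hAB.irreducible (star (B p) * W) (by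
      intro q
      have h1 : A q * (B p * (star (B p) * W)) = A q * W := by
        rw [← mul_assoc (B p), hAB.mul_star_right, one_mul]
      rw [hA, ← mul_assoc, hAB.weyl, smul_mul_assoc] at h1
      have h2 := smul_right_injective _ (Complex.exp_ne_zero _) h1
      change _ = _
      rw [mul_assoc, ← h2, mul_assoc, hconj]) (by
      intro p'
      have h1 : Commute (B p') (B p) := by
        rw [Commute, SemiconjBy, ← hAB.map_add_right, ← hAB.map_add_right, add_comm]
      have h2 : Commute (B p') (star (B p)) := by
        change _ = _
        calc B p' * star (B p) = star (B p) * (B p * (B p' * star (B p))) := (hconj _).symm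
          _ = star (B p) * (B p' * (B p * star (B p))) := by
            rw [← mul_assoc (B p), ← h1.eq, mul_assoc]
          _ = _ := by rw [hAB.mul_star_right, mul_one]
      exact h2.mul_right (hB p'))
  refine ⟨c, ?_⟩
  have : W = c • B p := by
    rw [← mul_one (B p), ← mul_smul_comm, ← hc, ← mul_assoc, hAB.mul_star_right, one_mul]
  rwa [← this]

theorem planeWave_add (p p' x : ℝ) : planeWave (p + p') x = planeWave p x * planeWave p' x := by
  rw [planeWave, planeWave, planeWave, ← Complex.exp_add]
  push_cast
  ring_nf

/-- Integration against a sharp observable is a star-homomorphism: multiplicativity of plane waves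
passes to `c`, and their unimodularity gives `‖c p‖ = 1`. -/
theorem exists_addChar_isIntegral_planeWave [Nontrivial H] (hAB : IsWeylPair A B)
    (hE : E.IsCovariant A B) (hs : E.IsSharp) :
    ∃ c : AddChar ℝ ℂ, (∀ p, ‖c p‖ = 1) ∧ ∀ p, E.IsIntegral (planeWave p) (c p • B p) := by
  choose c hc using hAB.exists_isIntegral_planeWave hE hs
  have hB : ∀ p, B p ≠ 0 := fun p h => by
    have := hAB.star_mul_right p
    rw [h, mul_zero] at this
    exact zero_ne_one this
  have hm := measurable_planeWave
  have hn : ∀ p x, ‖planeWave p x‖ ≤ 1 := fun p x => (norm_planeWave p x).le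
  have hadd : ∀ p p', c (p + p') = c p * c p' := by
    intro p p'
    have h1 := (hc p).mul hs (hm p) (hm p') (hn p) (hn p') (hc p')
    simp_rw [← planeWave_add] at h1
    have h2 := (hc (p + p')).unique h1
    rw [smul_mul_smul_comm, ← hAB.map_add_right] at h2
    exact smul_left_injective ℂ (hB _) h2
  have hnorm : ∀ p, ‖c p‖ = 1 := by
    intro p
    have h1 := (hc p).mul hs (hm p) (Complex.continuous_conj.measurable.comp (hm p)) (hn p)
      (fun x => (RCLike.norm_conj _).trans_le (hn p x)) (hc p).star
    have h2 : (fun x => planeWave p x * (starRingEnd ℂ ∘ planeWave p) x) = fun _ => 1 := by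
      ext x
      rw [Function.comp_apply, Complex.mul_conj, Complex.normSq_eq_norm_sq, norm_planeWave]
      simp
    rw [h2] at h1
    have h3 := E.isIntegral_one.unique h1
    rw [star_smul, smul_mul_smul_comm, hAB.mul_star_right, ← one_smul ℂ (1 : H →L[ℂ] H),
      smul_smul] at h3
    have h4 := smul_left_injective ℂ one_ne_zero h3
    simp only [mul_one, Complex.star_def, Complex.mul_conj, Complex.normSq_eq_norm_sq] at h4
    have h5 : (1 : ℝ) = ‖c p‖ ^ 2 := by exact_mod_cast h4
    nlinarith [norm_nonneg (c p)]
  have h0 : c 0 = 1 := by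
    have h1 := hadd 0 0
    rw [add_zero] at h1
    have h2 : c 0 ≠ 0 := norm_ne_zero_iff.mp (by rw [hnorm]; exact one_ne_zero)
    exact (mul_eq_left₀ h2).mp h1.symm
  exact ⟨⟨c, h0, hadd⟩, hnorm, hc⟩

/-- Two covariant sharp observables agree on the sets with a common period. -/
theorem exists_period [Nontrivial H] (hAB : IsWeylPair A B) {E₁ E₂ : Observable ℝ H}
    (h₁ : E₁.IsCovariant A B) (hs₁ : E₁.IsSharp) (h₂ : E₂.IsCovariant A B) (hs₂ : E₂.IsSharp) :
    ∃ p : ℝ, 0 < p ∧ (∀ Z, MeasurableSet Z →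
      E₁.eff (planeWave p ⁻¹' Z) = E₂.eff (planeWave p ⁻¹' Z)) ∧
      ∃ c : ℂ, c ≠ 0 ∧ E₁.IsIntegral (planeWave p) (c • B p) := by
  obtain ⟨c₁, hn₁, hc₁⟩ := hAB.exists_addChar_isIntegral_planeWave h₁ hs₁
  obtain ⟨c₂, hn₂, hc₂⟩ := hAB.exists_addChar_isIntegral_planeWave h₂ hs₂
  have hne₁ : ∀ p, c₁ p ≠ 0 := fun p => norm_ne_zero_iff.mp (by rw [hn₁]; exact one_ne_zero)
  have hne₂ : ∀ p, c₂ p ≠ 0 := fun p => norm_ne_zero_iff.mp (by rw [hn₂]; exact one_ne_zero)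
  have hr : ∀ p, (c₁ * c₂⁻¹) p = c₁ p / c₂ p := fun p => by
    rw [AddChar.mul_apply, AddChar.inv_apply, AddChar.map_neg_eq_inv, div_eq_mul_inv]
  -- `IsWeylPair` does not assume `B` continuous. In the ratio of the two characteristic functions
  -- of a state `ψ ≠ 0` the factor `⟪ψ, B p ψ⟫` cancels, so `c₁/c₂` is continuous at `0`, where the
  -- denominator is `‖ψ‖²`.
  obtain ⟨p, hp, hp1⟩ := AddChar.exists_pos_apply_eq_one (c₁ * c₂⁻¹) (by
      obtain ⟨ψ, hψ⟩ := exists_ne (0 : H)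
      have hk₁ := (E₁.continuous_integral_planeWave ψ).continuousAt (x := 0)
      have hk₂ := (E₂.continuous_integral_planeWave ψ).continuousAt (x := 0)
      have hz : ∫ x, planeWave 0 x ∂E₂.distribution ψ ≠ 0 := by
        simp only [planeWave, Complex.ofReal_zero, mul_zero, zero_mul, Complex.exp_zero,
          integral_const, Observable.distribution_real_univ]
        simpa using hψ
      refine (hk₁.div hk₂ hz).congr ?_
      filter_upwards [hk₂.eventually_ne hz] with p hp
      rw [hr, Pi.div_apply, ← hc₁ p ψ, ← hc₂ p ψ, smul_apply, smul_apply, inner_smul_right,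
        inner_smul_right]
      rw [← hc₂ p ψ, smul_apply, inner_smul_right] at hp
      exact mul_div_mul_right _ _ (right_ne_zero_of_mul hp))
    (fun p => by rw [hr, norm_div, hn₁, hn₂, div_one])
  rw [hr, div_eq_one_iff_eq (hne₂ p)] at hp1
  refine ⟨p, hp, ?_, c₁ p, hne₁ p, hc₁ p⟩
  have hT : Fact (0 < 2 * Real.pi / p) := ⟨by positivity⟩
  have hfou : ∀ (n : ℤ) (x : ℝ), fourier n (x : AddCircle (2 * Real.pi / p)) =
      planeWave (n • p) x := by
    intro n x
    rw [fourier_coe_apply, planeWave]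
    have : (p : ℂ) ≠ 0 := by exact_mod_cast hp.ne'
    have : (Real.pi : ℂ) ≠ 0 := by exact_mod_cast Real.pi_ne_zero
    congr 1
    rw [zsmul_eq_mul]
    push_cast
    field_simp
  have hmk : Measurable ((↑) : ℝ → AddCircle (2 * Real.pi / p)) :=
    (AddCircle.continuous_mk' _).measurable
  -- The `n`-th Fourier coefficient on the circle is the characteristic function at `n • p`, where
  -- `c₁(p)^n = c₂(p)^n`.
  have hmap : ∀ ψ, (E₁.distribution ψ).map ((↑) : ℝ → AddCircle (2 * Real.pi / p)) =
      (E₂.distribution ψ).map ((↑) : ℝ → AddCircle (2 * Real.pi / p)) := by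
    intro ψ
    refine AddCircle.measure_ext_of_integral_fourier fun n => ?_
    rw [integral_map hmk.aemeasurable (fourier n).continuous.aestronglyMeasurable,
      integral_map hmk.aemeasurable (fourier n).continuous.aestronglyMeasurable]
    simp_rw [hfou]
    rw [← hc₁ (n • p) ψ, ← hc₂ (n • p) ψ, AddChar.map_zsmul_eq_zpow, AddChar.map_zsmul_eq_zpow,
      hp1]
  intro Z hZ
  have hpre : planeWave p ⁻¹' Z = ((↑) : ℝ → AddCircle (2 * Real.pi / p)) ⁻¹'
      ((fourier (T := 2 * Real.pi / p) 1) ⁻¹' Z) := by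
    ext x
    rw [Set.mem_preimage, Set.mem_preimage, Set.mem_preimage, hfou, one_zsmul]
  have hZ' : MeasurableSet ((fourier (T := 2 * Real.pi / p) 1) ⁻¹' Z) :=
    (fourier (T := 2 * Real.pi / p) 1).continuous.measurable hZ
  refine ContinuousLinearMap.ext_inner_self fun ψ => ?_
  rw [E₁.inner_eff ψ (measurable_planeWave p hZ), E₂.inner_eff ψ (measurable_planeWave p hZ),
    hpre, measureReal_def, measureReal_def, ← Measure.map_apply hmk hZ',
    ← Measure.map_apply hmk hZ', hmap]

/-- Every observable that is coexistent with a mixture of two covariant sharp observables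
commutes with a nontrivial element of the invariance group. -/
theorem exists_commute_of_coexistent [Nontrivial H] (hAB : IsWeylPair A B)
    {E E₁ E₂ : Observable ℝ H} (h₁ : E₁.IsCovariant A B) (hs₁ : E₁.IsSharp)
    (h₂ : E₂.IsCovariant A B) (hs₂ : E₂.IsSharp) (hE : E.IsConvexCombination E₁ E₂)
    {Ω : Type*} [MeasurableSpace Ω] {F : Observable Ω H} (hF : E.Coexistent F) :
    ∃ p : ℝ, 0 < p ∧ ∀ Y, MeasurableSet Y → Commute (B p) (F.eff Y) := by
  obtain ⟨p, hp, hEE, c, hc, hW⟩ := hAB.exists_period h₁ hs₁ h₂ hs₂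
  refine ⟨p, hp, fun Y hY => ?_⟩
  obtain ⟨t, -, -, ht⟩ := hE
  obtain ⟨Ω', _, G, hG⟩ := hF
  have hcomm : Commute (c • B p) (F.eff Y) := by
    refine hW.commute hs₁ (measurable_planeWave p) (fun x => (norm_planeWave p x).le)
      fun Z hZ => ?_
    have hX := measurable_planeWave p hZ
    have hEX : E.eff (planeWave p ⁻¹' Z) = E₁.eff (planeWave p ⁻¹' Z) := by
      rw [ht _ hX, ← hEE Z hZ, ← add_smul, ← Complex.ofReal_add, add_sub_cancel,
        Complex.ofReal_one, one_smul]
    exact G.commute_of_isStarProjection (hG (Or.inl ⟨_, hX, hEX⟩)) (hs₁ _ ⟨_, hX, rfl⟩)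
      (hG (Or.inr ⟨_, hY, rfl⟩))
  have := hcomm.smul_left c⁻¹
  rwa [smul_smul, inv_mul_cancel₀ hc, one_smul] at this

end IsWeylPair

/-! ### No periodic observables -/

/-- An observable on the line with a nonzero period does not exist. -/
theorem Observable.not_periodic {H : Type*} [NormedAddCommGroup H] [InnerProductSpace ℂ H]
    [Nontrivial H] (F : Observable ℝ H) {p : ℝ} (hp : 0 < p)
    (h : ∀ Y, MeasurableSet Y → F.eff (shiftSet Y p) = F.eff Y) : False := by
  obtain ⟨ψ, hψ⟩ := exists_ne (0 : H)
  have hmap : (F.distribution ψ).map (fun x => x - p) = F.distribution ψ := by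
    ext Y hY
    have hm : Measurable fun x : ℝ => x - p := by fun_prop
    rw [Measure.map_apply hm hY, F.distribution_apply ψ hY, F.distribution_apply ψ (hm hY),
      ← shiftSet_eq_preimage, h Y hY]
  have hshift : ∀ s, MeasurableSet s →
      F.distribution ψ ((fun x => x - p) ⁻¹' s) = F.distribution ψ s := fun s hs => by
    conv_rhs => rw [← hmap, Measure.map_apply (by fun_prop) hs]
  -- Periodicity forces the disjoint half-lines `Iic 0` and `Ici p` each to carry the full mass
  -- `‖ψ‖²`.
  have hIic : ∀ n : ℕ, F.distribution ψ (Set.Iic (n * p)) = F.distribution ψ (Set.Iic 0) := by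
    intro n
    induction n with
    | zero => simp
    | succ n ih =>
      rw [← ih, ← hshift (Set.Iic (n * p)) measurableSet_Iic]
      congr 1
      ext x
      simp only [Set.mem_Iic, Set.mem_preimage, Nat.cast_add, Nat.cast_one]
      constructor <;> intro h <;> linarith
  have hIci : ∀ n : ℕ, F.distribution ψ (Set.Ici (-(n * p))) =
      F.distribution ψ (Set.Ici p) := by
    intro n
    induction n with
    | zero =>
      rw [← hshift _ measurableSet_Ici]
      congr 1
      ext x
      simp
    | succ n ih =>
      rw [← ih, ← hshift _ measurableSet_Ici]
      congr 1
      ext x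
      simp only [Set.mem_Ici, Set.mem_preimage, Nat.cast_add, Nat.cast_one]
      constructor <;> intro h <;> linarith
  have htop : Tendsto (fun n : ℕ => (n : ℝ) * p) atTop atTop :=
    tendsto_natCast_atTop_atTop.atTop_mul_const hp
  have h1 : F.distribution ψ (Set.Iic 0) = F.distribution ψ Set.univ := by
    refine tendsto_nhds_unique tendsto_const_nhds
      (((tendsto_measure_Iic_atTop (F.distribution ψ)).comp htop).congr hIic)
  have h2 : F.distribution ψ (Set.Ici p) = F.distribution ψ Set.univ := by
    refine tendsto_nhds_unique tendsto_const_nhds (((tendsto_measure_Ici_atBot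
      (F.distribution ψ)).comp (tendsto_neg_atTop_atBot.comp htop)).congr hIci)
  have h3 : F.distribution ψ (Set.Iic 0 ∪ Set.Ici p) =
      F.distribution ψ Set.univ + F.distribution ψ Set.univ := by
    rw [measure_union _ measurableSet_Ici, h1, h2]
    rw [Set.disjoint_left]
    intro x hx hx'
    exact (hp.trans_le hx').not_ge hx
  have h4 := h3.symm.trans_le (measure_mono (Set.subset_univ _))
  have h5 := F.distribution_real_univ ψ
  rw [measureReal_def] at h5
  have h6 := ENNReal.toReal_mono (measure_ne_top _ _) h4
  rw [ENNReal.toReal_add (measure_ne_top _ _) (measure_ne_top _ _), h5] at h6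
  have h7 : 0 < ‖ψ‖ ^ 2 := by positivity
  linarith

/-! ### Fourier uniqueness and translation invariant functions -/

/-- The finite measures with densities `f⁺` and `f⁻` have the same characteristic function, hence
coincide. The truncation built into `ENNReal.ofReal` produces these two parts. -/
theorem ae_eq_zero_of_integral_planeWave_mul_ofReal_eq_zero {f : ℝ → ℝ} (hf : Integrable f)
    (h : ∀ p, ∫ x, planeWave p x * (f x : ℂ) = 0) : f =ᵐ[volume] 0 := by
  have hpw : ∀ (g : ℝ → ℝ), Integrable g → ∀ p,
      Integrable (fun x => (g x).toNNReal • planeWave p x) := by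
    intro g hg p
    have := hg.real_toNNReal
    refine (this.ofReal (𝕜 := ℂ)).mul_bdd (c := 1)
      (measurable_planeWave p).aestronglyMeasurable (.of_forall fun x => (norm_planeWave p x).le)
  have hchar : ∀ (g : ℝ → ℝ), Integrable g → ∀ p,
      ∫ x, planeWave p x ∂(volume.withDensity fun x => ENNReal.ofReal (g x)) =
        ∫ x, (g x).toNNReal • planeWave p x := fun g hg p =>
    integral_withDensity_eq_integral_smul₀ hg.aemeasurable.real_toNNReal _
  have hfin : ∀ (g : ℝ → ℝ), Integrable g →
      IsFiniteMeasure (volume.withDensity fun x => ENNReal.ofReal (g x)) := fun g hg =>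
    isFiniteMeasure_withDensity_ofReal hg.hasFiniteIntegral
  have := hfin f hf
  have := hfin _ hf.neg
  have hm : (volume.withDensity fun x => ENNReal.ofReal (f x)) =
      volume.withDensity fun x => ENNReal.ofReal ((-f) x) := by
    refine Measure.ext_of_charFun (funext fun p => ?_)
    have hc : ∀ μ : Measure ℝ, charFun μ p = ∫ x, planeWave p x ∂μ := fun μ => by
      rw [charFun_apply_real]
      congr 1 with x
      rw [planeWave]
      ring_nf
    rw [hc, hc, hchar f hf, hchar _ hf.neg, ← sub_eq_zero, ← integral_sub (hpw f hf p)
      (hpw _ hf.neg p), ← h p]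
    congr 1 with x
    rw [NNReal.smul_def, NNReal.smul_def, ← sub_smul, Real.coe_toNNReal', Real.coe_toNNReal',
      Pi.neg_apply, max_zero_sub_max_neg_zero_eq_self, Complex.real_smul, mul_comm]
  rw [withDensity_eq_iff_of_sigmaFinite hf.aemeasurable.ennreal_ofReal
    hf.neg.aemeasurable.ennreal_ofReal] at hm
  filter_upwards [hm] with x hx
  have h1 := congrArg ENNReal.toReal hx
  rw [ENNReal.toReal_ofReal', ENNReal.toReal_ofReal', Pi.neg_apply] at h1
  rcases le_total (f x) 0 with h2 | h2
  · rw [max_eq_right h2, max_eq_left (by linarith)] at h1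
    simp only [Pi.zero_apply]; linarith
  · rw [max_eq_left h2, max_eq_right (by linarith)] at h1
    exact h1

/-- An integrable function with vanishing Fourier transform vanishes almost everywhere. -/
theorem ae_eq_zero_of_integral_planeWave_mul_eq_zero {f : ℝ → ℂ} (hf : Integrable f)
    (h : ∀ p, ∫ x, planeWave p x * f x = 0) : f =ᵐ[volume] 0 := by
  have hconj : ∀ p, ∫ x, planeWave p x * starRingEnd ℂ (f x) = 0 := by
    intro p
    have h1 := congrArg (starRingEnd ℂ) (h (-p))
    rw [← integral_conj, map_zero] at h1
    rw [← h1]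
    congr 1 with x
    rw [map_mul, planeWave, planeWave, ← Complex.exp_conj]
    simp
  have hi : ∀ (g : ℝ → ℂ), Integrable g → ∀ p, Integrable fun x => planeWave p x * g x :=
    fun g hg p => hg.bdd_mul (c := 1) (measurable_planeWave p).aestronglyMeasurable
      (.of_forall fun x => (norm_planeWave p x).le)
  have hfc : Integrable fun x => starRingEnd ℂ (f x) := by
    exact Complex.conjCLE.toContinuousLinearMap.integrable_comp hf
  have hre := ae_eq_zero_of_integral_planeWave_mul_ofReal_eq_zero hf.re (by
    intro p
    have : ∀ x, planeWave p x * ((RCLike.re (f x) : ℝ) : ℂ) =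
        (1 / 2 : ℂ) * (planeWave p x * f x + planeWave p x * starRingEnd ℂ (f x)) := by
      intro x
      rw [← mul_add, Complex.add_conj]
      simp
      ring
    simp_rw [this]
    rw [integral_const_mul, integral_add (hi f hf p) (hi _ hfc p), h, hconj]
    simp)
  have him := ae_eq_zero_of_integral_planeWave_mul_ofReal_eq_zero hf.im (by
    intro p
    have : ∀ x, planeWave p x * ((RCLike.im (f x) : ℝ) : ℂ) =
        (1 / (2 * Complex.I) : ℂ) *
          (planeWave p x * f x - planeWave p x * starRingEnd ℂ (f x)) := by
      intro x
      rw [← mul_sub, Complex.sub_conj]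
      have := Complex.I_ne_zero
      field_simp
      simp
      ring
    simp_rw [this]
    rw [integral_const_mul, integral_sub (hi f hf p) (hi _ hfc p), h, hconj]
    simp)
  filter_upwards [hre, him] with x h1 h2
  exact Complex.ext h1 h2

/-- A measurable function on the line that is invariant under all translations, almost
everywhere, is constant. -/
theorem ae_eq_const_of_forall_translate {m : ℝ → ℂ} (hm : AEStronglyMeasurable m volume)
    (h : ∀ q : ℝ, ∀ᵐ x, m (x - q) = m x) : ∃ c, ∀ᵐ x, m x = c := by
  obtain ⟨g, hg, hmg⟩ := hm
  have h1 : ∀ q : ℝ, ∀ᵐ x, g (x - q) = g x := by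
    intro q
    have h2 := (measurePreserving_sub_right volume q).quasiMeasurePreserving.ae_eq_comp hmg
    filter_upwards [h q, hmg, h2] with x hx hx1 hx2
    simp only [Function.comp_apply] at hx2
    rw [← hx1, ← hx2, hx]
  -- Fubini exchanges the quantifiers, so a single `x` serves almost every `q`. The measurable
  -- representative `g` makes the set of pairs measurable.
  have h2 : ∀ᵐ x : ℝ, ∀ᵐ q : ℝ, g (x - q) = g x := by
    rw [← Measure.ae_ae_comm]
    · exact .of_forall h1
    · exact measurableSet_eq_fun (hg.measurable.comp (by fun_prop))
        (hg.measurable.comp (by fun_prop))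
  obtain ⟨x, hx⟩ := h2.exists
  refine ⟨g x, ?_⟩
  have h3 := (Measure.measurePreserving_sub_left volume x).quasiMeasurePreserving.ae hx
  filter_upwards [h3, hmg] with y hy hy2
  rw [hy2, ← hy, sub_sub_cancel]

/-! ### The Weyl relations and irreducibility on `L²(ℝ)` -/

theorem translationU_add (q q' : ℝ) :
    translationU (q + q') = translationU q * translationU q' := by
  ext1 ψ
  refine Lp.ext ?_
  rw [mul_apply_eq_comp]
  have h := (measurePreserving_sub_right volume q).quasiMeasurePreserving.ae_eq_comp
    (translationU_coeFn q' ψ)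
  filter_upwards [translationU_coeFn (q + q') ψ, translationU_coeFn q (translationU q' ψ), h]
    with x h1 h2 h3
  simp only [Function.comp_apply] at h3
  rw [h1, h2, h3, sub_sub]

theorem boostV_add (p p' : ℝ) : boostV (p + p') = boostV p * boostV p' := by
  ext1 ψ
  refine Lp.ext ?_
  rw [mul_apply_eq_comp]
  filter_upwards [boostV_coeFn (p + p') ψ, boostV_coeFn p (boostV p' ψ), boostV_coeFn p' ψ]
    with x h1 h2 h3
  rw [h1, h2, h3, ← mul_assoc, ← Complex.exp_add]
  push_cast
  ring_nf

theorem translationU_zero : translationU 0 = 1 := by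
  ext1 ψ
  refine Lp.ext ?_
  filter_upwards [translationU_coeFn 0 ψ] with x h1
  rw [h1, sub_zero]
  rfl

theorem boostV_zero : boostV 0 = 1 := by
  ext1 ψ
  refine Lp.ext ?_
  filter_upwards [boostV_coeFn 0 ψ] with x h1
  rw [h1]
  simp

theorem star_translationU_mul (q : ℝ) : star (translationU q) * translationU q = 1 :=
  (ContinuousLinearMap.norm_map_iff_adjoint_comp_self _).mp fun ψ =>
    (Lp.compMeasurePreservingₗᵢ ℂ (fun x : ℝ => x - q)
      (measurePreserving_sub_right volume q)).norm_map ψ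

theorem star_boostV_mul (p : ℝ) : star (boostV p) * boostV p = 1 := by
  refine (ContinuousLinearMap.norm_map_iff_adjoint_comp_self _).mp fun ψ => ?_
  have h : ∀ᵐ x, ‖boostV p ψ x‖ = ‖ψ x‖ := by
    filter_upwards [boostV_coeFn p ψ] with x hx
    rw [hx, norm_mul, ← planeWave, norm_planeWave, one_mul]
  exact le_antisymm (Lp.norm_le_norm_of_ae_le (h.mono fun x hx => hx.le))
    (Lp.norm_le_norm_of_ae_le (h.mono fun x hx => hx.ge))

theorem translationU_mul_star (q : ℝ) : translationU q * star (translationU q) = 1 := by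
  have h : translationU q * translationU (-q) = 1 := by
    rw [← translationU_add, add_neg_cancel, translationU_zero]
  rwa [left_inv_eq_right_inv (star_translationU_mul q) h]

theorem boostV_mul_star (p : ℝ) : boostV p * star (boostV p) = 1 := by
  have h : boostV p * boostV (-p) = 1 := by
    rw [← boostV_add, add_neg_cancel, boostV_zero]
  rwa [left_inv_eq_right_inv (star_boostV_mul p) h]

theorem translationU_mul_boostV (q p : ℝ) : translationU q * boostV p =
    Complex.exp (-(Complex.I * p * q)) • (boostV p * translationU q) := by
  ext1 ψ
  refine Lp.ext ?_
  rw [smul_apply, mul_apply_eq_comp, mul_apply_eq_comp]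
  have h := (measurePreserving_sub_right volume q).quasiMeasurePreserving.ae_eq_comp
    (boostV_coeFn p ψ)
  filter_upwards [translationU_coeFn q (boostV p ψ), h, boostV_coeFn p (translationU q ψ),
    translationU_coeFn q ψ, Lp.coeFn_smul (Complex.exp (-(Complex.I * p * q)))
      (boostV p (translationU q ψ))] with x h1 h2 h3 h4 h5
  simp only [Function.comp_apply] at h2
  rw [h1, h2, h5, Pi.smul_apply, h3, h4, smul_eq_mul, ← mul_assoc, ← Complex.exp_add]
  push_cast
  ring_nf

/-- A strictly positive square integrable function. -/
theorem exists_ae_ne_zero : ∃ g : L2R, ∀ᵐ x, g x ≠ 0 := by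
  have h : MemLp (fun x : ℝ => ((Real.exp (-1 * x ^ 2) : ℝ) : ℂ)) 2 volume := by
    rw [memLp_two_iff_integrable_sq_norm
      (Continuous.aestronglyMeasurable (by fun_prop))]
    refine (integrable_exp_neg_mul_sq (b := 2) two_pos).congr (.of_forall fun x => ?_)
    simp only [Complex.norm_real, Real.norm_eq_abs, Real.abs_exp, ← Real.exp_nat_mul]
    congr 1
    push_cast
    ring
  refine ⟨h.toLp _, ?_⟩
  filter_upwards [h.coeFn_toLp] with x hx
  rw [hx]
  exact_mod_cast (Real.exp_pos _).ne'

/-- The commutant of the velocity boosts consists of multiplication operators. -/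
theorem ae_eq_of_commute_boostV {T : L2R →L[ℂ] L2R} (hT : ∀ p, Commute (boostV p) T)
    (φ ψ : L2R) : ∀ᵐ x, starRingEnd ℂ (star T φ x) * ψ x = starRingEnd ℂ (φ x) * T ψ x := by
  have hint : ∀ χ ξ : L2R, Integrable fun x => starRingEnd ℂ (χ x) * ξ x := by
    intro χ ξ
    simpa [mul_comm] using L2.integrable_inner (𝕜 := ℂ) χ ξ
  have hin : ∀ (χ ξ : L2R) p, ⟪χ, boostV p ξ⟫_ℂ =
      ∫ x, planeWave p x * (starRingEnd ℂ (χ x) * ξ x) := by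
    intro χ ξ p
    rw [L2.inner_def]
    refine integral_congr_ae ?_
    filter_upwards [boostV_coeFn p ξ] with x hx
    rw [hx, RCLike.inner_apply, planeWave]
    ring
  have hi : ∀ (g : ℝ → ℂ), Integrable g → ∀ p, Integrable fun x => planeWave p x * g x :=
    fun g hg p => hg.bdd_mul (c := 1) (measurable_planeWave p).aestronglyMeasurable
      (.of_forall fun x => (norm_planeWave p x).le)
  -- Both sides have the same Fourier transform, since `⟪star T φ, V(p) ψ⟫ = ⟪φ, V(p) T ψ⟫`.
  have h := ae_eq_zero_of_integral_planeWave_mul_eq_zero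
    ((hint (star T φ) ψ).sub (hint φ (T ψ))) (by
      intro p
      simp only [Pi.sub_apply, mul_sub]
      rw [integral_sub (hi _ (hint _ _) p) (hi _ (hint _ _) p), ← hin, ← hin,
        ContinuousLinearMap.star_eq_adjoint, ContinuousLinearMap.adjoint_inner_left, sub_eq_zero]
      exact congrArg _ (DFunLike.congr_fun (hT p).eq ψ).symm)
  filter_upwards [h] with x hx
  exact sub_eq_zero.mp hx

/-- The translations and the velocity boosts act irreducibly on `L²(ℝ)`. -/
theorem exists_eq_smul_one_of_commute {T : L2R →L[ℂ] L2R}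
    (hU : ∀ q, Commute (translationU q) T) (hV : ∀ p, Commute (boostV p) T) :
    ∃ c : ℂ, T = c • 1 := by
  obtain ⟨g, hg⟩ := exists_ae_ne_zero
  -- The multiplier is read off from `ae_eq_of_commute_boostV` with `φ = g`, which vanishes almost
  -- nowhere; commuting with translations then makes it constant.
  set m : ℝ → ℂ := fun x => starRingEnd ℂ (star T g x) / starRingEnd ℂ (g x) with hm
  have hmul : ∀ ψ : L2R, ∀ᵐ x, T ψ x = m x * ψ x := by
    intro ψ
    filter_upwards [ae_eq_of_commute_boostV hV g ψ, hg] with x hx hgx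
    have : starRingEnd ℂ (g x) ≠ 0 := (map_ne_zero _).mpr hgx
    rw [hm, div_mul_eq_mul_div, hx, mul_div_cancel_left₀ _ this]
  have hmm : AEStronglyMeasurable m volume := by
    have hc : ∀ χ : L2R, AEMeasurable (fun x => starRingEnd ℂ (χ x)) volume := fun χ =>
      Complex.continuous_conj.measurable.comp_aemeasurable (Lp.aestronglyMeasurable χ).aemeasurable
    exact ((hc _).div (hc _)).aestronglyMeasurable
  obtain ⟨c, hc⟩ := ae_eq_const_of_forall_translate hmm (by
    intro q
    have hmp := (measurePreserving_sub_right (volume : Measure ℝ) q).quasiMeasurePreserving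
    have h0 := DFunLike.congr_fun (hU q).eq g
    rw [mul_apply_eq_comp, mul_apply_eq_comp] at h0
    have h1 := translationU_coeFn q (T g)
    rw [h0] at h1
    filter_upwards [h1, hmul (translationU q g), translationU_coeFn q g, hmp.ae (hmul g),
      hmp.ae hg] with x h1 h2 h3 h4 h5
    rw [h2, h3, h4] at h1
    exact (mul_right_cancel₀ h5 h1).symm)
  refine ⟨c, ?_⟩
  ext1 ψ
  refine Lp.ext ?_
  rw [smul_apply, one_apply_eq_self]
  filter_upwards [hmul ψ, hc, Lp.coeFn_smul c ψ] with x h1 h2 h3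
  rw [h1, h2, h3, Pi.smul_apply, smul_eq_mul]

theorem isWeylPair_translationU_boostV : IsWeylPair translationU boostV where
  star_mul_left := star_translationU_mul
  star_mul_right := star_boostV_mul
  mul_star_right := boostV_mul_star
  map_add_right := boostV_add
  weyl := translationU_mul_boostV
  irreducible _ := exists_eq_smul_one_of_commute

/-- Exchanging the two groups inverts the phase in the Weyl relation; reversing the translations
restores it. -/
theorem isWeylPair_boostV_translationU : IsWeylPair boostV fun q => translationU (-q) where
  star_mul_left := star_boostV_mul
  star_mul_right q := star_translationU_mul (-q)
  mul_star_right q := translationU_mul_star (-q)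
  map_add_right q q' := by rw [neg_add, translationU_add]
  weyl p q := by
    rw [translationU_mul_boostV, smul_smul, ← Complex.exp_add]
    push_cast
    ring_nf
    simp
  irreducible _ hV hU :=
    exists_eq_smul_one_of_commute (fun q => by simpa using hU (-q)) hV

/-! ### The corollary -/

theorem IsPositionObservable.isCovariant {E : Observable ℝ L2R} (hE : IsPositionObservable E) :
    E.IsCovariant translationU boostV :=
  fun X hX => ⟨fun q => (hE q 0 X hX).1, fun p => (hE 0 p X hX).2⟩

theorem IsMomentumObservable.isCovariant {F : Observable ℝ L2R} (hF : IsMomentumObservable F) :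
    F.IsCovariant boostV fun q => translationU (-q) :=
  fun Y hY => ⟨fun p => (hF 0 p Y hY).1, fun q => (hF (-q) 0 Y hY).2⟩

instance : Nontrivial L2R := by
  obtain ⟨g, hg⟩ := exists_ae_ne_zero
  refine ⟨g, 0, fun h => ?_⟩
  rw [h] at hg
  obtain ⟨x, hx, hx0⟩ := (hg.and (Lp.coeFn_zero ℂ 2 (volume : Measure ℝ))).exists
  exact hx hx0

theorem conjBy_of_commute {A T : L2R →L[ℂ] L2R} (hA : A * star A = 1) (h : Commute A T) :
    conjBy A T = T := by
  change A * (T * star A) = T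
  rw [← mul_assoc, h.eq, mul_assoc, hA, mul_one]

theorem mainTheorem5 :
    (∀ E E₁ E₂ : Observable ℝ L2R,
      IsPositionObservable E →
      IsPositionObservable E₁ → E₁.IsSharp →
      IsPositionObservable E₂ → E₂.IsSharp →
      E.IsConvexCombination E₁ E₂ →
      ∀ F : Observable ℝ L2R, IsMomentumObservable F →
        ¬ Observable.Coexistent.{0, 0, 0, w} E F) ∧
    (∀ F F₁ F₂ : Observable ℝ L2R,
      IsMomentumObservable F →
      IsMomentumObservable F₁ → F₁.IsSharp →
      IsMomentumObservable F₂ → F₂.IsSharp →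
      F.IsConvexCombination F₁ F₂ →
      ∀ E : Observable ℝ L2R, IsPositionObservable E →
        ¬ Observable.Coexistent.{0, 0, 0, w} F E) := by
  refine ⟨fun E E₁ E₂ _ h₁ hs₁ h₂ hs₂ hE F hF hEF => ?_,
    fun F F₁ F₂ _ h₁ hs₁ h₂ hs₂ hF E hE hFE => ?_⟩
  · obtain ⟨p, hp, h⟩ := isWeylPair_translationU_boostV.exists_commute_of_coexistent
      h₁.isCovariant hs₁ h₂.isCovariant hs₂ hE hEF
    refine F.not_periodic hp fun Y hY => ?_
    rw [← (hF 0 p Y hY).1, conjBy_of_commute (boostV_mul_star p) (h Y hY)]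
  · obtain ⟨q, hq, h⟩ := isWeylPair_boostV_translationU.exists_commute_of_coexistent
      h₁.isCovariant hs₁ h₂.isCovariant hs₂ hF hFE
    refine E.not_periodic hq fun X hX => ?_
    -- The commuting unitary is the translation by `-q`, so covariance is applied to `X + q`, which
    -- it carries back to `X`.
    have hX' : MeasurableSet (shiftSet X q) := by
      rw [shiftSet_eq_preimage]
      exact measurableSet_preimage (by fun_prop) hX
    have h1 := (hE (-q) 0 _ hX').1
    rw [conjBy_of_commute (translationU_mul_star (-q)) (h _ hX')] at h1
    rw [h1]
    congr 1
    simp [shiftSet_eq_preimage, Set.preimage_preimage]
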